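/- Consider a matching market in which agents of type $H$ and of type $E$ arrive according to independent Poisson processes with rates $\lambda_H>0$ and $\lambda_E>0$. Every agent owns an item, and an agent of type $T\in\{H,E\}$ finds the item of any given other agent compatible with probability $p_T$, independently over all ordered pairs, where $p_E\in(0,1]$ is fixed and $p_H\in(0,1]$. Let $d\ge 1$ be an integer that does not depend on $p_H$. Initially there are $d$ altruistic agents, who give an item without receiving one; at all times there are exactly $d$ bridge agents, that is, agents who are altruistic or have received an item, and who have not yet given their own. Under the policy ChainMatch($d$), when an agent arrives who finds none of the bridge agents' items compatible, she joins the waiting agents. Otherwise one of the bridge agents with a compatible item, chosen uniformly at random, gives it to her, and a chain-segment starts: as long as some waiting agent finds the item of the last agent of the chain-segment compatible, one of these agents, chosen uniformly at random among those of type $H$ if there are any and among those of type $E$ otherwise, receives it, leaves the waiting agents, and becomes the last agent. When this stops, the last agent becomes a bridge agent. The chain-segment is carried out instantaneously, and an agent waits from her arrival until she receives an item. Then for every $p_H\in(0,1]$ the continuous-time Markov chain of the numbers of waiting $H$ and $E$ agents has exactly one stationary distribution, and the average waiting time $w_H=w_H(\lambda_H,\lambda_E,p_H,p_E,d)$ of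 $H$ agents in this steady state satisfies $$\limsup_{p_H\to 0^+} p_H\,w_H\;\le\;\frac{1}{\lambda_H}\ln\!\left(\frac{\lambda_H}{\lambda_E\bigl(1-(1-p_E)^d\bigr)}+1\right).$$ -/

import Mathlib

open scoped unitInterval ENNReal NNReal Topology

noncomputable section

namespace ChainMatching

/-- A coin that shows `true` with probability `p`. -/
def coin (p : I) : PMF Bool :=
  PMF.ofFintype
    (fun b => ((if b then unitInterval.toNNReal p else unitInterval.toNNReal (σ p) : ℝ≥0) : ℝ≥0∞))
    (by
      rw [Fintype.sum_bool, ← ENNReal.coe_add]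
      simp)

/-- `1 - (1 - p) ^ n`: the probability that at least one of `n` independent directed edges, each
present with probability `p`, exists. -/
def someEdge (p : I) (n : ℕ) : I := σ (σ p ^ n)

/-- The law of the numbers `(h', e')` of waiting `H` and `E` agents that are left over by a
chain-segment whose current last agent faces `h` waiting `H` agents and `e` waiting `E` agents.
The last agent finds some `H` agent that can receive from her with probability `1 - (1 - pH) ^ h`;
then an `H` agent is matched, leaves the pool and becomes the last agent. Otherwise she finds some
`E` agent that can receive from her with probability `1 - (1 - pE) ^ e`; then an `E` agent is
matched, leaves the pool and becomes the last agent. Otherwise the chain-segment ends. (The tests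
`0 < h` and `0 < e` are redundant: the coin shows `false` almost surely for an empty pool.) -/
def chainSegment (pH pE : I) (h e : ℕ) : PMF (ℕ × ℕ) :=
  (coin (someEdge pH h)).bind fun bH =>
    if _ : bH = true ∧ 0 < h then chainSegment pH pE (h - 1) e
    else
      (coin (someEdge pE e)).bind fun bE =>
        if _ : bE = true ∧ 0 < e then chainSegment pH pE h (e - 1)
        else PMF.pure (h, e)
termination_by h + e
decreasing_by all_goals omega

/-- The state after an `H` agent arrives at a market with `d` bridge (or altruistic) agents,
`s.1` waiting `H` agents and `s.2` waiting `E` agents. If one of the bridge agents can give to her,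
a chain-segment starts with her; otherwise she joins the waiting agents. -/
def arriveH (pH pE : I) (d : ℕ) (s : ℕ × ℕ) : PMF (ℕ × ℕ) :=
  (coin (someEdge pH d)).bind fun b =>
    if b then chainSegment pH pE s.1 s.2 else PMF.pure (s.1 + 1, s.2)

/-- The state after an `E` agent arrives. -/
def arriveE (pH pE : I) (d : ℕ) (s : ℕ × ℕ) : PMF (ℕ × ℕ) :=
  (coin (someEdge pE d)).bind fun b =>
    if b then chainSegment pH pE s.1 s.2 else PMF.pure (s.1, s.2 + 1)

/-- The rate at which the continuous-time Markov chain of the numbers of waiting `H` and `E` agents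
goes from `s` to `t`. For `s = t` this is the rate of the arrivals that leave the state
unchanged. -/
def rate (lamH lamE : ℝ) (pH pE : I) (d : ℕ) (s t : ℕ × ℕ) : ℝ≥0∞ :=
  ENNReal.ofReal lamH * arriveH pH pE d s t + ENNReal.ofReal lamE * arriveE pH pE d s t

/-- `π` is a steady-state distribution: for every state `t`, the flow into `t` equals the flow out
of `t` (the global balance equations). Arrivals that leave the state `t` unchanged are counted on
both sides, so that the total rate of leaving or staying is `lamH + lamE` in every state. -/
def IsSteadyState (lamH lamE : ℝ) (pH pE : I) (d : ℕ) (π : PMF (ℕ × ℕ)) : Prop :=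
  ∀ t : ℕ × ℕ,
    ∑' s : ℕ × ℕ, π s * rate lamH lamE pH pE d s t = ENNReal.ofReal (lamH + lamE) * π t

/-- The chain-segment seen by one tagged waiting `H` agent: `h` is the number of the other waiting
`H` agents, so that there are `h + 1` waiting `H` agents in all. Whenever an `H` agent is matched,
she is uniformly distributed among the waiting `H` agents. The outcome is `none` if the tagged agent
is matched, and otherwise consists of the numbers of other `H` agents and of `E` agents left. -/
def taggedSegment (pH pE : I) (h e : ℕ) : PMF (Option (ℕ × ℕ)) :=
  (coin (someEdge pH (h + 1))).bind fun bH =>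
    if bH then
      (PMF.uniformOfFintype (Fin (h + 1))).bind fun i =>
        if _ : i = 0 ∨ h = 0 then PMF.pure none
        else taggedSegment pH pE (h - 1) e
    else
      (coin (someEdge pE e)).bind fun bE =>
        if _ : bE = true ∧ 0 < e then taggedSegment pH pE h (e - 1)
        else PMF.pure (some (h, e))
termination_by h + e
decreasing_by all_goals omega

/-- What the arrival of an `H` agent does to a tagged waiting `H` agent and to the others. -/
def taggedArriveH (pH pE : I) (d : ℕ) (s : ℕ × ℕ) : PMF (Option (ℕ × ℕ)) :=
  (coin (someEdge pH d)).bind fun b =>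
    if b then taggedSegment pH pE s.1 s.2 else PMF.pure (some (s.1 + 1, s.2))

/-- What the arrival of an `E` agent does to a tagged waiting `H` agent and to the others. -/
def taggedArriveE (pH pE : I) (d : ℕ) (s : ℕ × ℕ) : PMF (Option (ℕ × ℕ)) :=
  (coin (someEdge pE d)).bind fun b =>
    if b then taggedSegment pH pE s.1 s.2 else PMF.pure (some (s.1, s.2 + 1))

/-- The probability that a tagged `H` agent, who waits together with `s.1` other `H` agents and
`s.2` `E` agents, is still waiting after the next `n` arrivals. Each arrival is of type `H` with
probability `lamH / (lamH + lamE)` and of type `E` with probability `lamE / (lamH + lamE)`. -/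
def stillWaiting (lamH lamE : ℝ) (pH pE : I) (d : ℕ) : ℕ → ℕ × ℕ → ℝ≥0∞
  | 0, _ => 1
  | n + 1, s =>
      ∑' t : ℕ × ℕ,
        (ENNReal.ofReal (lamH / (lamH + lamE)) * taggedArriveH pH pE d s (some t) +
          ENNReal.ofReal (lamE / (lamH + lamE)) * taggedArriveE pH pE d s (some t)) *
          stillWaiting lamH lamE pH pE d n t

/-- The expected time until a tagged waiting `H` agent is matched: she waits for as many arrivals
as it takes until she is matched, and consecutive arrivals are on average `1 / (lamH + lamE)` apart,
independently of the types and edges. -/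
def meanRemainingWait (lamH lamE : ℝ) (pH pE : I) (d : ℕ) (s : ℕ × ℕ) : ℝ≥0∞ :=
  (∑' n : ℕ, stillWaiting lamH lamE pH pE d n s) / ENNReal.ofReal (lamH + lamE)

/-- The average waiting time of `H` agents if the market is distributed according to `π`: an
arriving `H` agent finds the market in a state `s` distributed according to `π`. With probability
`1 - (1 - pH) ^ d` some bridge agent can give to her and she does not wait; otherwise she joins
the `s.1` waiting `H` agents. -/
def waitH (lamH lamE : ℝ) (pH pE : I) (d : ℕ) (π : PMF (ℕ × ℕ)) : ℝ≥0∞ :=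
  ∑' s : ℕ × ℕ, π s *
    (ENNReal.ofReal ((1 - (pH : ℝ)) ^ d) * meanRemainingWait lamH lamE pH pE d s)

end ChainMatching

end

/-! Arrivals have the constant total rate `lamH + lamE`, so the steady states are the stationary
laws of the jump chain `step`. From every state an `E` arrival can start a segment that empties the
pool, which gives uniqueness; the total number of waiting agents is a Lyapunov function, which gives
existence and finite mean pool sizes. For the bound, let `R = 1 - (1 - pE)^d` and `p = pH`. A
segment that meets `h` waiting `H` agents removes on average at least `expectedRun p h` of them,
about `exp (p h) - 1` for small `p`. In steady state the mean inflow of `H` agents balances these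
removals, so `lamE * R * E[exp (p h) - 1]` is at most about `lamH`. As `exp` is convex, Jensen's
inequality gives `p * E[h] ≤ y + O(p)` with `exp y - 1 = lamH / (lamE * R)`. The proof uses the
tangent line at `y` instead of Jensen (`le_expectedRun`, `mul_mean_fst_le`). Little's law
(`waitH_le`) turns `E[h]` into a waiting time. It rests on exchangeability: the count of `H` agents
evolves like one tagged agent, weighted by the number of candidates for the tag
(`chainSegment_eq_taggedSegment`). Only `lamH * wH ≤ E[h]` is needed. -/

/-- The expectation of a nonnegative function. -/
noncomputable def PMF.mean {α : Type*} (μ : PMF α) (f : α → ℝ≥0∞) : ℝ≥0∞ := ∑' x, μ x * f x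

namespace PMF

variable {α β : Type*}

theorem mean_pure (a : α) (f : α → ℝ≥0∞) : (PMF.pure a).mean f = f a := by
  classical
  rw [mean, tsum_eq_single a]
  · simp
  · intro b hb
    simp [PMF.pure_apply, hb]

theorem mean_bind (μ : PMF α) (κ : α → PMF β) (f : β → ℝ≥0∞) :
    (μ.bind κ).mean f = μ.mean fun x => (κ x).mean f := by
  simp only [mean, PMF.bind_apply, ← ENNReal.tsum_mul_right, ← ENNReal.tsum_mul_left]
  rw [ENNReal.tsum_comm]
  simp only [mul_assoc]

theorem mean_mono (μ : PMF α) {f g : α → ℝ≥0∞} (h : ∀ x, f x ≤ g x) : μ.mean f ≤ μ.mean g :=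
  ENNReal.tsum_le_tsum fun x => mul_le_mul_right (h x) _

theorem mean_add (μ : PMF α) (f g : α → ℝ≥0∞) :
    (μ.mean fun x => f x + g x) = μ.mean f + μ.mean g := by
  simp only [mean, mul_add, ENNReal.tsum_add]

theorem mean_const_mul (μ : PMF α) (c : ℝ≥0∞) (f : α → ℝ≥0∞) :
    (μ.mean fun x => c * f x) = c * μ.mean f := by
  simp only [mean, ← ENNReal.tsum_mul_left, mul_left_comm]

theorem mean_const (μ : PMF α) (c : ℝ≥0∞) : (μ.mean fun _ => c) = c := by
  simp only [mean, ENNReal.tsum_mul_right, μ.tsum_coe, one_mul]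

end PMF

theorem ENNReal.eq_of_le_of_tsum_le {α : Type*} {f g : α → ℝ≥0∞} (hle : ∀ x, f x ≤ g x)
    (hg : ∑' x, g x ≤ ∑' x, f x) (hf : ∑' x, f x ≠ ∞) : f = g := by
  by_contra hne
  obtain ⟨x, hx⟩ := Function.ne_iff.1 hne
  exact (ENNReal.tsum_lt_tsum hf hle (lt_of_le_of_ne (hle x) hx)).not_ge hg

/-! ### Stationary distributions of Markov chains: uniqueness and existence -/

namespace PMF

variable {α : Type*}

/-- If one state can be reached in one step from everywhere, then there is at most one stationary
distribution. -/
theorem stationary_unique {K : α → PMF α} {z : α} (hz : ∀ s, K s z ≠ 0) {π ν : PMF α}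
    (hπ : π.bind K = π) (hν : ν.bind K = ν) : ν = π := by
  have hπ' : ∀ t, ∑' s, π s * K s t = π t := fun t => by
    rw [← PMF.bind_apply, hπ]
  have hν' : ∀ t, ∑' s, ν s * K s t = ν t := fun t => by
    rw [← PMF.bind_apply, hν]
  have total : ∀ m : α → ℝ≥0∞, ∑' t, ∑' s, m s * K s t = ∑' s, m s := fun m => by
    rw [ENNReal.tsum_comm]
    simp only [ENNReal.tsum_mul_left, PMF.tsum_coe, mul_one]
  set m : α → ℝ≥0∞ := fun s => min (π s) (ν s) with hm
  have hmfin : ∑' s, m s ≠ ∞ :=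
    ne_top_of_le_ne_top π.tsum_coe_ne_top (ENNReal.tsum_le_tsum fun s => min_le_left _ _)
  -- The image of the minimum lies below both images, hence below the minimum; the kernel preserves
  -- total mass, so equality holds.
  have hminv : (fun t => ∑' s, m s * K s t) = m := by
    refine ENNReal.eq_of_le_of_tsum_le (fun t => le_min ?_ ?_) (total m).ge
      (by rwa [total m])
    · rw [← hπ' t]
      exact ENNReal.tsum_le_tsum fun s => mul_le_mul_left (min_le_left _ _) _
    · rw [← hν' t]
      exact ENNReal.tsum_le_tsum fun s => mul_le_mul_left (min_le_right _ _) _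
  -- A deficit of `m` at any state would send strictly less mass to `z`. At `z` the minimum agrees
  -- with one of the two laws, so that law lies below the other and, having the same total, equals
  -- it.
  have key : ∀ ρ : PMF α, (∀ t, ∑' s, ρ s * K s t = ρ t) → (∀ s, m s ≤ ρ s) → m z = ρ z →
      m = ρ := by
    intro ρ hρ hle hz'
    by_contra hne
    obtain ⟨x, hx⟩ := Function.ne_iff.1 hne
    have hlt : ∑' s, m s * K s z < ∑' s, ρ s * K s z := by
      refine ENNReal.tsum_lt_tsum (i := x) ?_ (fun s => mul_le_mul_left (hle s) _) ?_
      · rw [congrFun hminv z]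
        exact ne_top_of_le_ne_top (ρ.apply_ne_top z) (hle z)
      · exact (ENNReal.mul_lt_mul_iff_left (hz x) ((K x).apply_ne_top z)).2
          (lt_of_le_of_ne (hle x) hx)
    rw [hρ z, congrFun hminv z, hz'] at hlt
    exact lt_irrefl _ hlt
  rcases le_total (π z) (ν z) with h | h
  · have e := key π hπ' (fun s => min_le_left _ _) (min_eq_left h)
    refine (PMF.ext fun s => congrFun (ENNReal.eq_of_le_of_tsum_le (f := π) (g := ν) (fun s => ?_)
      ?_ π.tsum_coe_ne_top) s).symm
    · rw [← congrFun e s]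
      exact min_le_right _ _
    · rw [π.tsum_coe, ν.tsum_coe]
  · have e := key ν hν' (fun s => min_le_right _ _) (min_eq_right h)
    refine (PMF.ext fun s => congrFun (ENNReal.eq_of_le_of_tsum_le (f := ν) (g := π) (fun s => ?_)
      ?_ ν.tsum_coe_ne_top) s)
    · rw [← congrFun e s]
      exact min_le_left _ _
    · rw [π.tsum_coe, ν.tsum_coe]

/-- The law after `n` steps of the Markov chain with kernel `K`, started in `x`. -/
noncomputable def iterate (K : α → PMF α) (x : α) : ℕ → PMF α
  | 0 => PMF.pure x
  | n + 1 => (iterate K x n).bind K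

theorem mean_iterate_le {K : α → PMF α} {V : α → ℝ≥0∞} {r C M : ℝ≥0∞}
    (hV : ∀ s, (K s).mean V ≤ r * V s + C) (hM : r * M + C ≤ M) {x : α} (hx : V x ≤ M) (n : ℕ) :
    (iterate K x n).mean V ≤ M := by
  induction n with
  | zero => simpa [iterate, mean_pure] using hx
  | succ n ih =>
    rw [iterate, mean_bind]
    refine (mean_mono _ hV).trans ?_
    rw [mean_add, mean_const_mul, mean_const]
    exact le_trans (by gcongr) hM

/-- The average of the laws after `0, ..., n` steps. -/
noncomputable def occupation (K : α → PMF α) (x : α) (n : ℕ) (t : α) : ℝ≥0∞ :=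
  (n + 1 : ℝ≥0∞)⁻¹ * ∑ k ∈ Finset.range (n + 1), iterate K x k t

theorem tsum_occupation_mul_le {K : α → PMF α} {x : α} {f : α → ℝ≥0∞} {M : ℝ≥0∞}
    (h : ∀ n, (iterate K x n).mean f ≤ M) (n : ℕ) :
    ∑' t, occupation K x n t * f t ≤ M := by
  have e : ∑' t, occupation K x n t * f t
      = (n + 1 : ℝ≥0∞)⁻¹ * ∑ k ∈ Finset.range (n + 1), (iterate K x k).mean f := by
    simp only [occupation, mul_assoc, ENNReal.tsum_mul_left, Finset.sum_mul, mean]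
    rw [Summable.tsum_finsetSum fun _ _ => ENNReal.summable]
  rw [e]
  calc _ ≤ (n + 1 : ℝ≥0∞)⁻¹ * ∑ k ∈ Finset.range (n + 1), M := by
        gcongr
        exact h _
    _ = M := by
        rw [Finset.sum_const, Finset.card_range, nsmul_eq_mul, ← mul_assoc, Nat.cast_add,
          Nat.cast_one, ENNReal.inv_mul_cancel (by simp) (by simp), one_mul]

theorem tsum_occupation (K : α → PMF α) (x : α) (n : ℕ) : ∑' t, occupation K x n t = 1 := by
  simp only [occupation, ENNReal.tsum_mul_left]
  rw [Summable.tsum_finsetSum fun _ _ => ENNReal.summable]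
  simp only [PMF.tsum_coe, Finset.sum_const, Finset.card_range, nsmul_eq_mul, mul_one]
  rw [Nat.cast_add, Nat.cast_one, ENNReal.inv_mul_cancel (by simp) (by simp)]

/-- Applying the kernel shifts the averaging window by one step, so at most one new term of weight
`1 / (n + 1)` enters. Time averages are thus asymptotically invariant. -/
theorem tsum_occupation_mul_kernel_le (K : α → PMF α) (x : α) (n : ℕ) (t : α) :
    ∑' s, occupation K x n s * K s t ≤ occupation K x n t + (n + 1 : ℝ≥0∞)⁻¹ := by
  have e : ∑' s, occupation K x n s * K s t
      = (n + 1 : ℝ≥0∞)⁻¹ * ∑ k ∈ Finset.range (n + 1), iterate K x (k + 1) t := by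
    simp only [occupation, mul_assoc, ENNReal.tsum_mul_left, Finset.sum_mul, iterate,
      PMF.bind_apply]
    rw [Summable.tsum_finsetSum fun _ _ => ENNReal.summable]
  rw [e, occupation]
  calc _ ≤ (n + 1 : ℝ≥0∞)⁻¹ * (∑ k ∈ Finset.range (n + 1), iterate K x k t + 1) := by
        gcongr
        calc _ ≤ ∑ k ∈ Finset.range (n + 2), iterate K x k t := by
              rw [Finset.sum_range_succ' _ (n + 1)]
              exact le_self_add
          _ ≤ _ := by
              rw [Finset.sum_range_succ _ (n + 1)]
              gcongr
              exact PMF.coe_le_one _ _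
    _ = _ := by rw [mul_add, mul_one]

/-- A Markov chain with a Lyapunov function with finite sublevel sets has a stationary
distribution, under which the Lyapunov function has finite mean. -/
theorem exists_stationary {K : α → PMF α} {V : α → ℝ≥0∞} {r C : ℝ≥0∞}
    (hV : ∀ s, (K s).mean V ≤ r * V s + C) (hr : r < 1) (hC : C ≠ ∞) {x : α} (hx : V x = 0)
    (hVtop : ∀ s, V s ≠ ∞) (hfin : ∀ N : ℕ, {s | V s ≤ N}.Finite) :
    ∃ π : PMF α, π.bind K = π ∧ π.mean V ≠ ∞ := by
  classical
  have hr0 : 1 - r ≠ 0 := (tsub_pos_of_lt hr).ne'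
  have hr1 : 1 - r ≠ ∞ := ne_top_of_le_ne_top ENNReal.one_ne_top tsub_le_self
  -- The fixed point of `M ↦ r * M + C`, so that the drift inequality preserves the bound `M`.
  set M : ℝ≥0∞ := C / (1 - r) with hMdef
  have hMtop : M ≠ ∞ := ENNReal.div_ne_top hC hr0
  have hM : r * M + C ≤ M := by
    have h1 : (1 - r) * M = C := ENNReal.mul_div_cancel hr0 hr1
    rw [← h1, ← add_mul, add_tsub_cancel_of_le hr.le, one_mul]
  have hmean : ∀ n, (iterate K x n).mean V ≤ M :=
    mean_iterate_le hV hM (by simp [hx])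
  -- Krylov–Bogoliubov: a pointwise limit of the time averages along an ultrafilter exists by
  -- compactness of the product. It could lose mass; the Lyapunov function excludes this.
  obtain ⟨π₀, -, hπ₀⟩ := (isCompact_univ (X := α → ℝ≥0∞)).ultrafilter_le_nhds
    ((Filter.hyperfilter ℕ : Ultrafilter ℕ).map (occupation K x)) (by simp)
  have hlim : ∀ t, Filter.Tendsto (fun n => occupation K x n t) (Filter.hyperfilter ℕ) (𝓝 (π₀ t)) :=
    fun t => (tendsto_pi_nhds.1 hπ₀) t
  have hmul : ∀ (F : Finset α) (f : α → ℝ≥0∞), (∀ s, f s ≠ ∞) →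
      Filter.Tendsto (fun n => ∑ s ∈ F, occupation K x n s * f s) (Filter.hyperfilter ℕ)
        (𝓝 (∑ s ∈ F, π₀ s * f s)) := fun F f hf =>
    tendsto_finsetSum _ fun s _ => ENNReal.Tendsto.mul_const (hlim s) (Or.inr (hf s))
  have hsum : ∀ F : Finset α,
      Filter.Tendsto (fun n => ∑ s ∈ F, occupation K x n s) (Filter.hyperfilter ℕ)
        (𝓝 (∑ s ∈ F, π₀ s)) := fun F => tendsto_finsetSum _ fun s _ => hlim s
  have hle1 : ∑' s, π₀ s ≤ 1 := by
    rw [ENNReal.tsum_eq_iSup_sum]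
    refine iSup_le fun F => le_of_tendsto (hsum F) (.of_forall fun n => ?_)
    exact (ENNReal.sum_le_tsum F).trans (tsum_occupation K x n).le
  have hVle : ∑' s, π₀ s * V s ≤ M := by
    rw [ENNReal.tsum_eq_iSup_sum]
    refine iSup_le fun F => le_of_tendsto (hmul F V hVtop) (.of_forall fun n => ?_)
    exact (ENNReal.sum_le_tsum F).trans (tsum_occupation_mul_le hmean n)
  -- Markov's inequality bounds the mass outside the finite set `V ≤ N + 1`, uniformly in the time;
  -- on the finite set the limit is harmless.
  have hge : ∀ N : ℕ, 1 ≤ ∑' s, π₀ s + M * ((N : ℝ≥0∞) + 1)⁻¹ := by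
    intro N
    refine le_trans (ge_of_tendsto ((hsum (hfin (N + 1)).toFinset).add_const _)
      (.of_forall fun n => ?_)) (add_le_add_left (ENNReal.sum_le_tsum _) _)
    have hpt : ∀ t, occupation K x n t ≤
        (if t ∈ (hfin (N + 1)).toFinset then occupation K x n t else 0) +
          occupation K x n t * V t * ((N : ℝ≥0∞) + 1)⁻¹ := by
      intro t
      split_ifs with h
      · exact le_self_add
      · have hN : (N : ℝ≥0∞) + 1 ≤ V t := by
          have : ¬ V t ≤ ((N + 1 : ℕ) : ℝ≥0∞) := by simpa using h
          simpa using (not_le.1 this).le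
        rw [zero_add, mul_assoc]
        refine le_mul_of_one_le_right' ?_
        rw [← div_eq_mul_inv]
        exact (ENNReal.le_div_iff_mul_le (by simp) (by simp)).2 (by simpa using hN)
    refine (tsum_occupation K x n).ge.trans ((ENNReal.tsum_le_tsum hpt).trans ?_)
    rw [ENNReal.tsum_add, ENNReal.tsum_mul_right]
    gcongr
    · rw [tsum_eq_sum (s := (hfin (N + 1)).toFinset) (fun b hb => if_neg hb)]
      exact Finset.sum_le_sum fun b hb => by rw [if_pos hb]
    · exact tsum_occupation_mul_le hmean n
  have hge1 : 1 ≤ ∑' s, π₀ s := by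
    have ht : Filter.Tendsto (fun N : ℕ => ∑' s, π₀ s + M * ((N : ℝ≥0∞) + 1)⁻¹) Filter.atTop
        (𝓝 (∑' s, π₀ s + M * 0)) := by
      refine tendsto_const_nhds.add (ENNReal.Tendsto.const_mul ?_ (Or.inr hMtop))
      have := (Filter.tendsto_add_atTop_iff_nat 1).2 ENNReal.tendsto_inv_nat_nhds_zero
      simpa using this
    simpa using ge_of_tendsto ht (.of_forall hge)
  have hone : ∑' s, π₀ s = 1 := le_antisymm hle1 hge1
  -- Passing to the limit in finite partial sums yields only an inequality; equality follows from
  -- equal total masses.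
  have hsub : ∀ t, ∑' s, π₀ s * K s t ≤ π₀ t := by
    intro t
    have hinv : Filter.Tendsto (fun n : ℕ => ((n : ℝ≥0∞) + 1)⁻¹) (Filter.hyperfilter ℕ) (𝓝 0) := by
      have := (Filter.tendsto_add_atTop_iff_nat 1).2 ENNReal.tendsto_inv_nat_nhds_zero
      simp only [Nat.cast_add, Nat.cast_one] at this
      exact this.mono_left (Nat.hyperfilter_le_atTop)
    rw [ENNReal.tsum_eq_iSup_sum]
    refine iSup_le fun F => ?_
    have := le_of_tendsto_of_tendsto (hmul F (fun s => K s t) fun s => (K s).apply_ne_top t)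
      ((hlim t).add hinv) (.of_forall fun n =>
        (ENNReal.sum_le_tsum F).trans (tsum_occupation_mul_kernel_le K x n t))
    simpa using this
  have htot : ∑' t, ∑' s, π₀ s * K s t = ∑' s, π₀ s := by
    rw [ENNReal.tsum_comm]
    simp only [ENNReal.tsum_mul_left, PMF.tsum_coe, mul_one]
  have hinv := ENNReal.eq_of_le_of_tsum_le hsub htot.ge (by rw [htot, hone]; simp)
  let π : PMF α := ⟨π₀, hone ▸ ENNReal.summable.hasSum⟩
  refine ⟨π, PMF.ext fun t => ?_, ?_⟩
  · rw [PMF.bind_apply]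
    exact congrFun hinv t
  · exact ne_top_of_le_ne_top hMtop hVle

end PMF

/-! ### Expected effect of a chain-segment -/

namespace ChainMatching

theorem coin_true (p : I) : coin p true = ENNReal.ofReal p := by
  simp [coin, unitInterval.toNNReal, ENNReal.ofReal, Real.toNNReal_of_nonneg p.2.1]
  rfl

theorem coin_false (p : I) : coin p false = ENNReal.ofReal (1 - p) := by
  simp [coin, unitInterval.toNNReal, ENNReal.ofReal,
    Real.toNNReal_of_nonneg (sub_nonneg.2 p.2.2)]
  rfl

theorem coin_bind_apply {α : Type*} (p : I) (g : Bool → PMF α) (t : α) :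
    ((coin p).bind g) t = ENNReal.ofReal p * g true t + ENNReal.ofReal (1 - p) * g false t := by
  rw [PMF.bind_apply, tsum_bool, coin_true, coin_false, add_comm]

theorem mean_coin_bind {α : Type*} (p : I) (g : Bool → PMF α) (f : α → ℝ≥0∞) :
    ((coin p).bind g).mean f
      = ENNReal.ofReal p * (g true).mean f + ENNReal.ofReal (1 - p) * (g false).mean f := by
  rw [PMF.mean_bind, PMF.mean, tsum_bool, coin_true, coin_false, add_comm]

theorem coe_someEdge (p : I) (n : ℕ) : (someEdge p n : ℝ) = 1 - (1 - (p : ℝ)) ^ n := by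
  simp [someEdge]

theorem someEdge_zero (p : I) : (someEdge p 0 : ℝ) = 0 := by
  simp [coe_someEdge]

theorem someEdge_pos {p : I} (hp : 0 < p) {n : ℕ} (hn : n ≠ 0) : 0 < (someEdge p n : ℝ) := by
  rw [coe_someEdge, sub_pos]
  have hp' : (0 : ℝ) < p := hp
  exact pow_lt_one₀ (sub_nonneg.2 p.2.2) (by linarith) hn

theorem chainSegment_apply (pH pE : I) (h e : ℕ) (t : ℕ × ℕ) :
    chainSegment pH pE h e t =
      ENNReal.ofReal (someEdge pH h) * chainSegment pH pE (h - 1) e t +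
        ENNReal.ofReal (1 - someEdge pH h) *
          (ENNReal.ofReal (someEdge pE e) * chainSegment pH pE h (e - 1) t +
            ENNReal.ofReal (1 - someEdge pE e) * PMF.pure (h, e) t) := by
  conv_lhs => rw [chainSegment]
  rw [coin_bind_apply]
  congr 1
  · rcases Nat.eq_zero_or_pos h with rfl | hh
    · simp [someEdge_zero]
    · simp [hh]
  · simp only [Bool.false_eq_true, false_and, dite_false]
    rw [coin_bind_apply]
    congr 2
    rcases Nat.eq_zero_or_pos e with rfl | he
    · simp [someEdge_zero]
    · simp [he]

theorem mean_chainSegment (pH pE : I) (h e : ℕ) (f : ℕ × ℕ → ℝ≥0∞) :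
    (chainSegment pH pE h e).mean f =
      ENNReal.ofReal (someEdge pH h) * (chainSegment pH pE (h - 1) e).mean f +
        ENNReal.ofReal (1 - someEdge pH h) *
          (ENNReal.ofReal (someEdge pE e) * (chainSegment pH pE h (e - 1)).mean f +
            ENNReal.ofReal (1 - someEdge pE e) * f (h, e)) := by
  rw [← PMF.mean_pure (h, e) f]
  conv_lhs => rw [PMF.mean]
  simp only [chainSegment_apply pH pE h e, PMF.mean, add_mul, mul_assoc, ENNReal.tsum_add,
    ENNReal.tsum_mul_left]

/-- A supersolution of the one-step equations of the chain-segment bounds the mean. -/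
theorem mean_chainSegment_le (pH pE : I) (f : ℕ × ℕ → ℝ≥0∞) (F : ℕ → ℕ → ℝ) (G : ℕ → ℕ → ℝ)
    (hF : ∀ h e, 0 ≤ F h e) (hG : ∀ h e, 0 ≤ G h e)
    (hfG : ∀ h e, f (h, e) ≤ ENNReal.ofReal (G h e))
    (hsup : ∀ h e, someEdge pH h * F (h - 1) e + (1 - someEdge pH h) *
      (someEdge pE e * F h (e - 1) + (1 - someEdge pE e) * G h e) ≤ F h e) (h e : ℕ) :
    (chainSegment pH pE h e).mean f ≤ ENNReal.ofReal (F h e) := by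
  induction hn : h + e using Nat.strong_induction_on generalizing h e with
  | _ n ih =>
    have hH := (someEdge pH h).2
    have hE := (someEdge pE e).2
    rw [mean_chainSegment]
    refine le_trans ?_ (ENNReal.ofReal_le_ofReal (hsup h e))
    have hH' := sub_nonneg.2 hH.2
    have hE' := sub_nonneg.2 hE.2
    have h1 := hF (h - 1) e
    have h2 := hF h (e - 1)
    have h3 := hG h e
    have hEF := mul_nonneg hE.1 h2
    have hEG := mul_nonneg hE' h3
    rw [ENNReal.ofReal_add (mul_nonneg hH.1 h1) (mul_nonneg hH' (add_nonneg hEF hEG)),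
      ENNReal.ofReal_mul hH.1, ENNReal.ofReal_mul hH',
      ENNReal.ofReal_add hEF hEG, ENNReal.ofReal_mul hE.1, ENNReal.ofReal_mul hE']
    refine add_le_add ?_ (mul_le_mul_right (add_le_add ?_ (mul_le_mul_right (hfG h e) _)) _)
    · rcases Nat.eq_zero_or_pos h with rfl | hh
      · simp [someEdge_zero]
      · exact mul_le_mul_right (ih (h - 1 + e) (by omega) _ _ rfl) _
    · rcases Nat.eq_zero_or_pos e with rfl | he
      · simp [someEdge_zero]
      · exact mul_le_mul_right (ih (h + (e - 1)) (by omega) _ _ rfl) _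

/-- The expected length of a run of matches that each succeed with probability
`1 - (1 - p) ^ n` when `n` agents are left. -/
noncomputable def expectedRun (p : I) : ℕ → ℝ
  | 0 => 0
  | n + 1 => someEdge p (n + 1) * (1 + expectedRun p n)

theorem expectedRun_eq (p : I) (n : ℕ) :
    expectedRun p n = someEdge p n * (1 + expectedRun p (n - 1)) := by
  cases n with
  | zero => simp [expectedRun, someEdge_zero]
  | succ n => simp [expectedRun]

theorem expectedRun_nonneg (p : I) (n : ℕ) : 0 ≤ expectedRun p n := by
  induction n with
  | zero => exact le_rfl
  | succ n ih => exact mul_nonneg (someEdge p (n + 1)).2.1 (by linarith)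

theorem expectedRun_le (p : I) (n : ℕ) : expectedRun p n ≤ n := by
  induction n with
  | zero => simp [expectedRun]
  | succ n ih =>
    have h0 := expectedRun_nonneg p n
    rw [expectedRun]
    push_cast
    have := mul_le_of_le_one_left (by linarith : 0 ≤ 1 + expectedRun p n) (someEdge p (n + 1)).2.2
    linarith

/-- The expected run lies above the line that is tangent at `y` to a slight rescaling of
`x ↦ exp x - 1`, where `x` is `p` times the number of agents. -/
theorem le_expectedRun (p : I) (y : ℝ) (n : ℕ) :
    (Real.exp y * (1 - y) - 1 + Real.exp y * p * n) / (1 + p * Real.exp y) ≤ expectedRun p n := by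
  have hp0 : (0 : ℝ) ≤ p := p.2.1
  have hE := Real.exp_pos y
  set E := Real.exp y with hEdef
  have hD : 0 < 1 + p * E := by positivity
  have tangent : ∀ x : ℝ, E * (1 - y) + E * x ≤ Real.exp x := by
    intro x
    have h1 := Real.add_one_le_exp (x - y)
    have h2 : Real.exp x = E * Real.exp (x - y) := by
      rw [hEdef, ← Real.exp_add]; congr 1; ring
    rw [h2]
    nlinarith
  induction n with
  | zero =>
    rw [div_le_iff₀ hD]
    have := tangent 0
    rw [Real.exp_zero] at this
    simp [expectedRun]
    linarith
  | succ n ih =>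
    rw [div_le_iff₀ hD] at ih ⊢
    have hg := expectedRun_nonneg p n
    have ha := (someEdge p (n + 1)).2
    have hq : (1 - (p : ℝ)) ^ (n + 1) * Real.exp (p * (n + 1)) ≤ 1 := by
      have h1 : 1 - (p : ℝ) ≤ Real.exp (-p) := by
        have := Real.add_one_le_exp (-(p : ℝ)); linarith
      have h2 : (1 - (p : ℝ)) ^ (n + 1) ≤ Real.exp (-(p * (n + 1))) := by
        refine (pow_le_pow_left₀ (sub_nonneg.2 p.2.2) h1 _).trans ?_
        rw [← Real.exp_nat_mul]
        apply le_of_eq; congr 1; push_cast; ring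
      calc _ ≤ Real.exp (-(p * (n + 1))) * Real.exp (p * (n + 1)) := by gcongr
        _ = 1 := by rw [← Real.exp_add]; simp
    have hq0 : 0 ≤ (1 - (p : ℝ)) ^ (n + 1) := pow_nonneg (sub_nonneg.2 p.2.2) _
    have ht := tangent (p * (n + 1))
    rw [expectedRun, coe_someEdge]
    push_cast
    set q := (1 - (p : ℝ)) ^ (n + 1)
    have hq1 : q ≤ 1 := pow_le_one₀ (sub_nonneg.2 p.2.2) (by linarith)
    -- Write `L` for the tangent line at `p * (n + 1)`. The denominator `1 + p * E` is chosen so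
    -- that adding one match to the bound for `n` gives exactly `L`; the claim becomes `(1 - q) * L
    -- ≥ L - 1`, that is `q * L ≤ 1`.
    have h3 : q * (E * (1 - y) + E * (p * (n + 1))) ≤ 1 :=
      (mul_le_mul_of_nonneg_left ht hq0).trans hq
    have h4 : (1 - q) * (E * (1 - y) - 1 + E * p * n + (1 + p * E)) ≤
        (1 - q) * ((1 + expectedRun p n) * (1 + p * E)) := by
      refine mul_le_mul_of_nonneg_left ?_ (by linarith)
      linarith
    linarith

/-- The first unbroken run of `H` matches already removes `expectedRun pH h` agents on average. An
`E` match after it can only lead to further `H` matches. -/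
theorem mean_fst_chainSegment_le (pH pE : I) (h e : ℕ) :
    (chainSegment pH pE h e).mean (fun t => (t.1 : ℝ≥0∞)) ≤
      ENNReal.ofReal (h - expectedRun pH h) := by
  refine mean_chainSegment_le pH pE _ (fun h _ => h - expectedRun pH h) (fun h _ => h)
    (fun h _ => sub_nonneg.2 (expectedRun_le pH h)) (fun h _ => Nat.cast_nonneg h)
    (fun h _ => by simp) (fun h e => ?_) h e
  have hH := (someEdge pH h).2
  have hE := (someEdge pE e).2
  have hg := expectedRun_nonneg pH h
  have h1 : someEdge pE e * ((h : ℝ) - expectedRun pH h) + (1 - someEdge pE e) * h ≤ (h : ℝ) := by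
    nlinarith [mul_nonneg hE.1 hg]
  have h2 := mul_le_mul_of_nonneg_left h1 (sub_nonneg.2 hH.2)
  have h3 : (someEdge pH h : ℝ) * (((h - 1 : ℕ) : ℝ) - expectedRun pH (h - 1)) +
      (1 - someEdge pH h) * h = h - expectedRun pH h := by
    rw [expectedRun_eq pH h]
    rcases Nat.eq_zero_or_pos h with rfl | hh
    · simp [someEdge_zero]
    · rw [Nat.cast_sub hh]; push_cast; ring
  linarith

/-- `H` matches leave `e` unchanged and a failed `E` test ends the segment, so the number of `E`
matches is governed by the run for `pE` alone. -/
theorem mean_snd_chainSegment_le (pH pE : I) (h e : ℕ) :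
    (chainSegment pH pE h e).mean (fun t => (t.2 : ℝ≥0∞)) ≤
      ENNReal.ofReal (e - expectedRun pE e) := by
  refine mean_chainSegment_le pH pE _ (fun _ e => e - expectedRun pE e) (fun _ e => e)
    (fun _ e => sub_nonneg.2 (expectedRun_le pE e)) (fun _ e => Nat.cast_nonneg e)
    (fun _ e => by simp) (fun h e => ?_) h e
  have h3 : (someEdge pE e : ℝ) * (((e - 1 : ℕ) : ℝ) - expectedRun pE (e - 1)) +
      (1 - someEdge pE e) * e = e - expectedRun pE e := by
    rw [expectedRun_eq pE e]
    rcases Nat.eq_zero_or_pos e with rfl | hh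
    · simp [someEdge_zero]
    · rw [Nat.cast_sub hh]; push_cast; ring
  rw [h3]
  exact le_of_eq (by ring)

theorem chainSegment_zero_ne_zero {pH pE : I} (hpH : 0 < pH) (hpE : 0 < pE) (h e : ℕ) :
    chainSegment pH pE h e (0, 0) ≠ 0 := by
  induction hn : h + e using Nat.strong_induction_on generalizing h e with
  | _ n ih =>
    rw [chainSegment_apply]
    rcases Nat.eq_zero_or_pos h with rfl | hh
    · rcases Nat.eq_zero_or_pos e with rfl | he
      · simp [someEdge_zero]
      · have := ih (0 + (e - 1)) (by omega) 0 (e - 1) rfl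
        have := someEdge_pos hpE he.ne'
        simp [someEdge_zero, *]
    · have := ih (h - 1 + e) (by omega) (h - 1) e rfl
      have := someEdge_pos hpH hh.ne'
      simp [*]

theorem chainSegment_zero_succ (pH pE : I) (e h' e' : ℕ) :
    chainSegment pH pE 0 e (h' + 1, e') = 0 := by
  induction e with
  | zero => rw [chainSegment_apply]; simp [someEdge_zero, PMF.pure_apply]
  | succ e ih => rw [chainSegment_apply]; simp [someEdge_zero, PMF.pure_apply, ih]

/-! ### Exchangeability of the waiting `H` agents -/

theorem uniformOfFintype_bind_apply {α : Type*} (h : ℕ) (a b : PMF α) (t : α) :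
    ((PMF.uniformOfFintype (Fin (h + 1))).bind fun i => if i = 0 then a else b) t =
      ((h : ℝ≥0∞) + 1)⁻¹ * (a t + h * b t) := by
  rw [PMF.bind_apply, tsum_fintype, Fin.sum_univ_succ]
  simp [Fin.succ_ne_zero]
  ring

/-- A uniform choice among `h + 1` agents spares the tagged one with probability `h / (h + 1)`.
Multiplying by `h + 1` clears the denominator and gives the recursion of `chainSegment`; at `h = 0`
the factor `h` kills the truncated `h - 1`. -/
theorem taggedSegment_apply (pH pE : I) (h e : ℕ) (t : ℕ × ℕ) :
    ((h : ℝ≥0∞) + 1) * taggedSegment pH pE h e (some t) =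
      ENNReal.ofReal (someEdge pH (h + 1)) * (h * taggedSegment pH pE (h - 1) e (some t)) +
        ENNReal.ofReal (1 - someEdge pH (h + 1)) *
          (ENNReal.ofReal (someEdge pE e) *
              (((h : ℝ≥0∞) + 1) * taggedSegment pH pE h (e - 1) (some t)) +
            ENNReal.ofReal (1 - someEdge pE e) * (((h : ℝ≥0∞) + 1) * PMF.pure (h, e) t)) := by
  have hu : (((PMF.uniformOfFintype (Fin (h + 1))).bind fun i =>
      if _ : i = 0 ∨ h = 0 then PMF.pure none else taggedSegment pH pE (h - 1) e) :
        PMF (Option (ℕ × ℕ))) (some t) =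
      ((h : ℝ≥0∞) + 1)⁻¹ * (h * taggedSegment pH pE (h - 1) e (some t)) := by
    rcases Nat.eq_zero_or_pos h with rfl | hh
    · simp
    · have := uniformOfFintype_bind_apply h (PMF.pure none) (taggedSegment pH pE (h - 1) e) (some t)
      simpa [hh.ne'] using this
  have he : (((coin (someEdge pE e)).bind fun bE =>
      if _ : bE = true ∧ 0 < e then taggedSegment pH pE h (e - 1)
        else PMF.pure (some (h, e))) : PMF (Option (ℕ × ℕ))) (some t) =
      ENNReal.ofReal (someEdge pE e) * taggedSegment pH pE h (e - 1) (some t) +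
        ENNReal.ofReal (1 - someEdge pE e) * PMF.pure (h, e) t := by
    rw [coin_bind_apply]
    congr 1
    · rcases Nat.eq_zero_or_pos e with rfl | he
      · simp [someEdge_zero]
      · simp [he]
    · simp [PMF.pure_apply]
  conv_lhs => rw [taggedSegment]
  rw [coin_bind_apply]
  simp only [if_true, Bool.false_eq_true, if_false]
  rw [hu, he, mul_add, mul_left_comm, ← mul_assoc ((h : ℝ≥0∞) + 1),
    ENNReal.mul_inv_cancel (by simp) (by simp), one_mul]
  ring

/-- By exchangeability, the expected number of waiting `H` agents who survive a chain-segment is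
the number before it times the survival probability of a tagged one. -/
theorem chainSegment_eq_taggedSegment (pH pE : I) (h e h' e' : ℕ) :
    ((h' : ℝ≥0∞) + 1) * chainSegment pH pE (h + 1) e (h' + 1, e') =
      ((h : ℝ≥0∞) + 1) * taggedSegment pH pE h e (some (h', e')) := by
  induction hn : h + e using Nat.strong_induction_on generalizing h e with
  | _ n ih =>
    rw [taggedSegment_apply, chainSegment_apply, mul_add, mul_left_comm,
      mul_left_comm _ (ENNReal.ofReal (1 - someEdge pH (h + 1))), mul_add,
      mul_left_comm _ (ENNReal.ofReal (someEdge pE e)),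
      mul_left_comm _ (ENNReal.ofReal (1 - someEdge pE e))]
    congr 2
    · rcases Nat.eq_zero_or_pos h with rfl | hh
      · simp [chainSegment_zero_succ]
      · obtain ⟨k, rfl⟩ := Nat.exists_eq_succ_of_ne_zero hh.ne'
        simpa using ih (k + e) (by omega) k e rfl
    · congr 1
      · rcases Nat.eq_zero_or_pos e with rfl | he
        · simp [someEdge_zero]
        · rw [ih (h + (e - 1)) (by omega) h (e - 1) rfl]
      · congr 1
        simp only [PMF.pure_apply, Prod.mk.injEq, Nat.add_right_cancel_iff]
        split_ifs with hc
        · rw [hc.1]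
        · simp

end ChainMatching

/-! ### The jump chain: drift and steady state -/

namespace ChainMatching

/-- The state after the next arrival, which is of type `H` with probability `a`. -/
noncomputable def step (a pH pE : I) (d : ℕ) (s : ℕ × ℕ) : PMF (ℕ × ℕ) :=
  (coin a).bind fun b => if b then arriveH pH pE d s else arriveE pH pE d s

theorem step_apply (a pH pE : I) (d : ℕ) (s t : ℕ × ℕ) :
    step a pH pE d s t =
      ENNReal.ofReal a * arriveH pH pE d s t + ENNReal.ofReal (1 - a) * arriveE pH pE d s t := by
  rw [step, coin_bind_apply]
  simp

theorem arriveH_apply (pH pE : I) (d : ℕ) (s t : ℕ × ℕ) :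
    arriveH pH pE d s t = ENNReal.ofReal (someEdge pH d) * chainSegment pH pE s.1 s.2 t +
      ENNReal.ofReal (1 - someEdge pH d) * PMF.pure (s.1 + 1, s.2) t := by
  rw [arriveH, coin_bind_apply]
  simp

theorem arriveE_apply (pH pE : I) (d : ℕ) (s t : ℕ × ℕ) :
    arriveE pH pE d s t = ENNReal.ofReal (someEdge pE d) * chainSegment pH pE s.1 s.2 t +
      ENNReal.ofReal (1 - someEdge pE d) * PMF.pure (s.1, s.2 + 1) t := by
  rw [arriveE, coin_bind_apply]
  simp

theorem isSteadyState_iff {lamH lamE : ℝ} (hH : 0 < lamH) (hE : 0 < lamE) {a : I}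
    (ha : (a : ℝ) = lamH / (lamH + lamE)) (pH pE : I) (d : ℕ) (π : PMF (ℕ × ℕ)) :
    IsSteadyState lamH lamE pH pE d π ↔ π.bind (step a pH pE d) = π := by
  have hsum : 0 < lamH + lamE := by linarith
  have h1 : lamH = (lamH + lamE) * a := by rw [ha]; field_simp
  have h2 : lamE = (lamH + lamE) * (1 - a) := by rw [ha]; field_simp; ring
  have hrate : ∀ s t, rate lamH lamE pH pE d s t =
      ENNReal.ofReal (lamH + lamE) * step a pH pE d s t := by
    intro s t
    rw [rate, step_apply, mul_add, ← mul_assoc, ← mul_assoc, ← ENNReal.ofReal_mul hsum.le,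
      ← ENNReal.ofReal_mul hsum.le, ← h1, ← h2]
  have h0 : ENNReal.ofReal (lamH + lamE) ≠ 0 := by simpa using hsum
  simp only [IsSteadyState, hrate, mul_left_comm _ (ENNReal.ofReal (lamH + lamE)),
    ENNReal.tsum_mul_left, ENNReal.mul_right_inj h0 ENNReal.ofReal_ne_top]
  rw [PMF.ext_iff]
  simp only [PMF.bind_apply]

theorem step_zero_ne_zero {a pH pE : I} (ha : a < 1) (hpH : 0 < pH) (hpE : 0 < pE) {d : ℕ}
    (hd : d ≠ 0) (s : ℕ × ℕ) : step a pH pE d s (0, 0) ≠ 0 := by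
  have h1 : (a : ℝ) < 1 := ha
  have h2 := someEdge_pos hpE hd
  have h3 := chainSegment_zero_ne_zero hpH hpE s.1 s.2
  rw [step_apply, arriveE_apply]
  simp [h1, h2, h3]

theorem mean_step_le (a pH pE : I) (d : ℕ) (s : ℕ × ℕ) {f : ℕ × ℕ → ℝ≥0∞} {x y z : ℝ}
    (hx : 0 ≤ x) (hy : 0 ≤ y) (hz : 0 ≤ z)
    (hfx : (chainSegment pH pE s.1 s.2).mean f ≤ ENNReal.ofReal x)
    (hfy : f (s.1 + 1, s.2) ≤ ENNReal.ofReal y) (hfz : f (s.1, s.2 + 1) ≤ ENNReal.ofReal z) :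
    (step a pH pE d s).mean f ≤ ENNReal.ofReal
      (a * (someEdge pH d * x + (1 - someEdge pH d) * y) +
        (1 - a) * (someEdge pE d * x + (1 - someEdge pE d) * z)) := by
  have ha := a.2
  have hP := (someEdge pH d).2
  have hR := (someEdge pE d).2
  have ha' := sub_nonneg.2 ha.2
  have hP' := sub_nonneg.2 hP.2
  have hR' := sub_nonneg.2 hR.2
  have p1 := mul_nonneg hP.1 hx
  have p2 := mul_nonneg hP' hy
  have p3 := mul_nonneg hR.1 hx
  have p4 := mul_nonneg hR' hz
  rw [step, mean_coin_bind, ENNReal.ofReal_add (mul_nonneg ha.1 (add_nonneg p1 p2))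
    (mul_nonneg ha' (add_nonneg p3 p4)), ENNReal.ofReal_mul ha.1, ENNReal.ofReal_mul ha',
    ENNReal.ofReal_add p1 p2, ENNReal.ofReal_add p3 p4, ENNReal.ofReal_mul hP.1,
    ENNReal.ofReal_mul hP', ENNReal.ofReal_mul hR.1, ENNReal.ofReal_mul hR']
  simp only [if_true, Bool.false_eq_true, if_false, arriveH, arriveE, mean_coin_bind,
    PMF.mean_pure]
  gcongr

/-- Only segments started by `E` arrivals are credited; the gain from `H` arrivals matched at once,
and from the segments they start, is dropped. -/
theorem mean_fst_step_le (a pH pE : I) (d : ℕ) (s : ℕ × ℕ) :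
    (step a pH pE d s).mean (fun t => (t.1 : ℝ≥0∞)) ≤
      ENNReal.ofReal (s.1 + a - (1 - a) * someEdge pE d * expectedRun pH s.1) := by
  refine (mean_step_le a pH pE d s (sub_nonneg.2 (expectedRun_le pH s.1))
    (add_nonneg (Nat.cast_nonneg s.1) zero_le_one) (Nat.cast_nonneg s.1)
    (mean_fst_chainSegment_le pH pE s.1 s.2) ?_ ?_).trans (ENNReal.ofReal_le_ofReal ?_)
  · rw [ENNReal.ofReal_add (Nat.cast_nonneg _) zero_le_one]; simp
  · simp
  · have h1 := mul_nonneg a.2.1 (mul_nonneg (someEdge pH d).2.1 (expectedRun_nonneg pH s.1))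
    have h2 := mul_nonneg a.2.1 (someEdge pH d).2.1
    linarith

theorem mean_snd_step_le (a pH pE : I) (d : ℕ) (s : ℕ × ℕ) :
    (step a pH pE d s).mean (fun t => (t.2 : ℝ≥0∞)) ≤
      ENNReal.ofReal (s.2 + 1 - (1 - a) * someEdge pE d * expectedRun pE s.2) := by
  refine (mean_step_le a pH pE d s (sub_nonneg.2 (expectedRun_le pE s.2))
    (Nat.cast_nonneg s.2) (add_nonneg (Nat.cast_nonneg s.2) zero_le_one)
    (mean_snd_chainSegment_le pH pE s.1 s.2) ?_ ?_).trans (ENNReal.ofReal_le_ofReal ?_)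
  · simp
  · rw [ENNReal.ofReal_add (Nat.cast_nonneg _) zero_le_one]; simp
  · have h1 := mul_nonneg a.2.1 (mul_nonneg (someEdge pH d).2.1 (expectedRun_nonneg pE s.2))
    have h2 := mul_nonneg (sub_nonneg.2 a.2.2) (someEdge pE d).2.1
    have h3 := a.2.1
    linarith

/-- Every positive edge probability gives a linear lower bound on the expected run. -/
theorem mul_le_expectedRun (p : I) (n : ℕ) : (p : ℝ) / (1 + p) * n ≤ expectedRun p n := by
  refine le_trans (le_of_eq ?_) (le_expectedRun p 0 n)
  simp
  ring

theorem ofReal_sub_expectedRun_le {p : I} {c b δ : ℝ} (hc : 0 ≤ c) (hb : b ≤ 1) (hδ1 : δ ≤ 1)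
    (hδ : δ ≤ c * (p / (1 + p))) (n : ℕ) :
    ENNReal.ofReal (n + b - c * expectedRun p n) ≤ ENNReal.ofReal (1 - δ) * n + 1 := by
  have h1 : ENNReal.ofReal (1 - δ) * n + 1 = ENNReal.ofReal ((1 - δ) * n + 1) := by
    rw [ENNReal.ofReal_add (mul_nonneg (by linarith) (Nat.cast_nonneg n)) zero_le_one,
      ENNReal.ofReal_mul (by linarith)]
    simp
  rw [h1]
  refine ENNReal.ofReal_le_ofReal ?_
  have h2 := mul_le_mul_of_nonneg_left (mul_le_expectedRun p n) hc
  have h3 := mul_le_mul_of_nonneg_right hδ (Nat.cast_nonneg (α := ℝ) n)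
  linarith

theorem exists_stationary_step {a pH pE : I} (ha : a < 1) (hpH : 0 < pH) (hpE : 0 < pE) {d : ℕ}
    (hd : d ≠ 0) : ∃ π : PMF (ℕ × ℕ), π.bind (step a pH pE d) = π ∧
      π.mean (fun s => (s.1 : ℝ≥0∞)) ≠ ∞ := by
  have ha' : (a : ℝ) < 1 := ha
  have hH : (0 : ℝ) < pH := hpH
  have hE : (0 : ℝ) < pE := hpE
  have hR := someEdge_pos hpE hd
  set c : ℝ := (1 - a) * someEdge pE d with hcdef
  have hc : 0 < c := mul_pos (by linarith) hR
  have hc1 : c ≤ 1 := mul_le_one₀ (by linarith [a.2.1]) hR.le (someEdge pE d).2.2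
  -- The smaller of the two linear removal rates, so that both coordinates contract by the common
  -- factor `1 - δ`.
  set δ : ℝ := c * min ((pH : ℝ) / (1 + pH)) ((pE : ℝ) / (1 + pE)) with hδdef
  have hδ : 0 < δ := mul_pos hc (lt_min (by positivity) (by positivity))
  have hδH : δ ≤ c * (pH / (1 + pH)) := mul_le_mul_of_nonneg_left (min_le_left _ _) hc.le
  have hδE : δ ≤ c * (pE / (1 + pE)) := mul_le_mul_of_nonneg_left (min_le_right _ _) hc.le
  have hδ1 : δ ≤ 1 := by
    refine hδH.trans (mul_le_one₀ hc1 (by positivity) ?_)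
    rw [div_le_one (by positivity)]
    linarith
  have hdrift : ∀ s, (step a pH pE d s).mean (fun t => (t.1 : ℝ≥0∞) + t.2) ≤
      ENNReal.ofReal (1 - δ) * (s.1 + s.2) + 2 := by
    intro s
    rw [PMF.mean_add]
    calc _ ≤ (ENNReal.ofReal (1 - δ) * s.1 + 1) + (ENNReal.ofReal (1 - δ) * s.2 + 1) :=
          add_le_add
            ((mean_fst_step_le a pH pE d s).trans
              (ofReal_sub_expectedRun_le hc.le a.2.2 hδ1 hδH s.1))
            ((mean_snd_step_le a pH pE d s).trans
              (ofReal_sub_expectedRun_le hc.le le_rfl hδ1 hδE s.2))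
      _ = _ := by rw [mul_add, ← one_add_one_eq_two]; ring
  obtain ⟨π, h1, h2⟩ := PMF.exists_stationary hdrift (by simpa using hδ) (by simp)
    (x := (0, 0)) (by simp) (fun s => by simp) (fun N => by
      refine ((Set.finite_Iic N).prod (Set.finite_Iic N)).subset fun s hs => ?_
      have : s.1 + s.2 ≤ N := by exact_mod_cast (hs : (s.1 : ℝ≥0∞) + s.2 ≤ N)
      exact ⟨by simp only [Set.mem_Iic]; omega, by simp only [Set.mem_Iic]; omega⟩)
  exact ⟨π, h1, ne_top_of_le_ne_top h2 (PMF.mean_mono _ fun s => le_self_add)⟩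

/-- In steady state, `pH` times the mean number of waiting `H` agents is at most `y` up to an error
that vanishes with `pH`. -/
theorem mul_mean_fst_le {a pH pE : I} {d : ℕ} {y : ℝ} (hy : 0 ≤ y) (ha : a < 1) (hpE : 0 < pE)
    (hd : d ≠ 0) (hbal : (a : ℝ) = (1 - a) * someEdge pE d * (Real.exp y - 1))
    {π : PMF (ℕ × ℕ)} (hπ : π.bind (step a pH pE d) = π)
    (hfin : π.mean (fun s => (s.1 : ℝ≥0∞)) ≠ ∞) :
    ENNReal.ofReal pH * π.mean (fun s => (s.1 : ℝ≥0∞)) ≤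
      ENNReal.ofReal (y + (Real.exp y - 1) * pH) := by
  have ha' : (a : ℝ) < 1 := ha
  have hp : (0 : ℝ) ≤ pH := pH.2.1
  set c : ℝ := (1 - a) * someEdge pE d with hcdef
  have hc : 0 < c := mul_pos (by linarith) (someEdge_pos hpE hd)
  have hE := Real.exp_pos y
  have hE1 := Real.one_le_exp hy
  set E := Real.exp y with hEdef
  have hD : 0 < 1 + pH * E := by positivity
  set k : ℝ := c * E / (1 + pH * E) with hk
  have hk0 : 0 < k := by positivity
  have hb0 : 0 ≤ y + (E - 1) * pH := add_nonneg hy (mul_nonneg (by linarith) hp)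
  have hpt : ∀ s : ℕ × ℕ, (step a pH pE d s).mean (fun t => (t.1 : ℝ≥0∞)) +
      ENNReal.ofReal (k * pH) * s.1 ≤ s.1 + ENNReal.ofReal (k * (y + (E - 1) * pH)) := by
    intro s
    have hrun := mul_le_mul_of_nonneg_left (le_expectedRun pH y s.1) hc.le
    -- `k * pH` is the slope of `c` times the tangent bound, so the terms in `s.1` cancel; `hbal`
    -- evaluates the constant that remains.
    have hval : (s.1 : ℝ) + a - c * ((E * (1 - y) - 1 + E * pH * s.1) / (1 + pH * E)) +
        k * pH * s.1 = s.1 + k * (y + (E - 1) * pH) := by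
      rw [hbal, hk]
      field_simp
      ring
    have hnn : 0 ≤ (s.1 : ℝ) + a - c * expectedRun pH s.1 := by
      have h1 := mul_le_mul_of_nonneg_left (expectedRun_le pH s.1) hc.le
      have h2 : c ≤ 1 := mul_le_one₀ (by linarith [a.2.1]) (someEdge pE d).2.1 (someEdge pE d).2.2
      have h3 := mul_le_mul_of_nonneg_right h2 (Nat.cast_nonneg (α := ℝ) s.1)
      have h4 := a.2.1
      linarith
    have hn : (s.1 : ℝ≥0∞) = ENNReal.ofReal (s.1 : ℝ) := by simp
    calc _ ≤ ENNReal.ofReal (s.1 + a - c * expectedRun pH s.1) +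
          ENNReal.ofReal (k * pH) * s.1 := by
            gcongr
            exact mean_fst_step_le a pH pE d s
      _ = ENNReal.ofReal (s.1 + a - c * expectedRun pH s.1 + k * pH * s.1) := by
            rw [hn, ← ENNReal.ofReal_mul (by positivity), ← ENNReal.ofReal_add hnn (by positivity)]
      _ ≤ ENNReal.ofReal (s.1 + k * (y + (E - 1) * pH)) := by
            refine ENNReal.ofReal_le_ofReal ?_
            rw [← hEdef] at hrun
            linarith
      _ = _ := by rw [ENNReal.ofReal_add (by positivity) (by positivity), ← hn]
  -- Averaging over the stationary law makes the means before and after the step equal; they cancel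
  -- because they are finite.
  have hmean := π.mean_mono hpt
  rw [PMF.mean_add, PMF.mean_add, ← PMF.mean_bind, hπ, PMF.mean_const_mul, PMF.mean_const,
    ENNReal.add_le_add_iff_left hfin, ENNReal.ofReal_mul hk0.le, ENNReal.ofReal_mul hk0.le,
    mul_assoc, ENNReal.mul_le_mul_iff_right (by simpa using hk0) ENNReal.ofReal_ne_top] at hmean
  exact hmean

/-! ### Little's law -/

/-- The probability that the next arrival takes a tagged `H` agent with `s` others waiting to the
state in which she waits with `t` others. -/
noncomputable def taggedStep (a pH pE : I) (d : ℕ) (s t : ℕ × ℕ) : ℝ≥0∞ :=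
  ENNReal.ofReal a * taggedArriveH pH pE d s (some t) +
    ENNReal.ofReal (1 - a) * taggedArriveE pH pE d s (some t)

theorem taggedArriveH_apply (pH pE : I) (d : ℕ) (s t : ℕ × ℕ) :
    taggedArriveH pH pE d s (some t) =
      ENNReal.ofReal (someEdge pH d) * taggedSegment pH pE s.1 s.2 (some t) +
        ENNReal.ofReal (1 - someEdge pH d) * PMF.pure (s.1 + 1, s.2) t := by
  rw [taggedArriveH, coin_bind_apply]
  simp [PMF.pure_apply]

theorem taggedArriveE_apply (pH pE : I) (d : ℕ) (s t : ℕ × ℕ) :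
    taggedArriveE pH pE d s (some t) =
      ENNReal.ofReal (someEdge pE d) * taggedSegment pH pE s.1 s.2 (some t) +
        ENNReal.ofReal (1 - someEdge pE d) * PMF.pure (s.1, s.2 + 1) t := by
  rw [taggedArriveE, coin_bind_apply]
  simp [PMF.pure_apply]

/-- With no `H` agent waiting, one can be present afterwards only if an `H` arrival joins the pool.
-/
theorem step_zero_apply (a pH pE : I) (d : ℕ) (e : ℕ) (t : ℕ × ℕ) :
    ((t.1 : ℝ≥0∞) + 1) * step a pH pE d (0, e) (t.1 + 1, t.2) =
      ENNReal.ofReal a * ENNReal.ofReal (1 - someEdge pH d) * PMF.pure t (0, e) := by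
  obtain ⟨h', e'⟩ := t
  rw [step_apply, arriveH_apply, arriveE_apply]
  simp only [chainSegment_zero_succ, PMF.pure_apply, Prod.mk.injEq]
  by_cases hc : h' = 0 ∧ e' = e
  · obtain ⟨rfl, rfl⟩ := hc
    simp
  · have hc' : ¬ (0 = h' ∧ e = e') := fun h => hc ⟨h.1.symm, h.2.symm⟩
    simp [hc, hc']

/-- Each of the `t.1 + 1` `H` agents present afterwards is either the newcomer, who sees the old
state as the others, or a survivor among the `h + 1` old ones. -/
theorem step_succ_apply (a pH pE : I) (d : ℕ) (h e : ℕ) (t : ℕ × ℕ) :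
    ((t.1 : ℝ≥0∞) + 1) * step a pH pE d (h + 1, e) (t.1 + 1, t.2) =
      ENNReal.ofReal a * ENNReal.ofReal (1 - someEdge pH d) * PMF.pure t (h + 1, e) +
        ((h : ℝ≥0∞) + 1) * taggedStep a pH pE d (h, e) t := by
  obtain ⟨h', e'⟩ := t
  have h1 : ((h' : ℝ≥0∞) + 1) * PMF.pure (h + 1 + 1, e) (h' + 1, e') =
      PMF.pure (h', e') (h + 1, e) + ((h : ℝ≥0∞) + 1) * PMF.pure (h + 1, e) (h', e') := by
    simp only [PMF.pure_apply, Prod.mk.injEq, Nat.add_right_cancel_iff, @eq_comm _ (h + 1) h',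
      @eq_comm _ e e']
    split_ifs with hc
    · rw [hc.1]; push_cast; ring
    · simp
  have h2 : ((h' : ℝ≥0∞) + 1) * PMF.pure (h + 1, e + 1) (h' + 1, e') =
      ((h : ℝ≥0∞) + 1) * PMF.pure (h, e + 1) (h', e') := by
    simp only [PMF.pure_apply, Prod.mk.injEq, Nat.add_right_cancel_iff]
    split_ifs with hc
    · rw [hc.1]
    · simp
  rw [step_apply, taggedStep, arriveH_apply, arriveE_apply, taggedArriveH_apply,
    taggedArriveE_apply]
  dsimp only
  calc _ = ENNReal.ofReal a * (ENNReal.ofReal (someEdge pH d) *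
          (((h' : ℝ≥0∞) + 1) * chainSegment pH pE (h + 1) e (h' + 1, e')) +
            ENNReal.ofReal (1 - someEdge pH d) *
              (((h' : ℝ≥0∞) + 1) * PMF.pure (h + 1 + 1, e) (h' + 1, e'))) +
        ENNReal.ofReal (1 - a) * (ENNReal.ofReal (someEdge pE d) *
          (((h' : ℝ≥0∞) + 1) * chainSegment pH pE (h + 1) e (h' + 1, e')) +
            ENNReal.ofReal (1 - someEdge pE d) *
              (((h' : ℝ≥0∞) + 1) * PMF.pure (h + 1, e + 1) (h' + 1, e'))) := by ring
    _ = _ := by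
      rw [chainSegment_eq_taggedSegment, h1, h2]
      ring

/-- A measure `m` that dominates the new mass `α` plus its own image under a substochastic kernel
dominates the expected total number of visits. -/
theorem tsum_mul_sum_survival_le {S : Type*} {Q : S → S → ℝ≥0∞} {w : ℕ → S → ℝ≥0∞}
    (hw0 : ∀ s, w 0 s = 1) (hw : ∀ n s, w (n + 1) s = ∑' t, Q s t * w n t) {α m : S → ℝ≥0∞}
    (hm : ∀ t, α t + ∑' s, m s * Q s t ≤ m t) :
    ∑' s, α s * ∑' n, w n s ≤ ∑' s, m s := by
  -- Testing `hm` against `w n` gives a telescoping inequality. In additive form it needs no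
  -- finiteness.
  have hstep : ∀ n, ∑' s, α s * w n s + ∑' s, m s * w (n + 1) s ≤ ∑' s, m s * w n s := by
    intro n
    have e : ∑' s, m s * w (n + 1) s = ∑' t, (∑' s, m s * Q s t) * w n t := by
      simp only [hw, ← ENNReal.tsum_mul_left, ← ENNReal.tsum_mul_right]
      rw [ENNReal.tsum_comm]
      simp only [mul_assoc]
    rw [e, ← ENNReal.tsum_add]
    refine ENNReal.tsum_le_tsum fun t => ?_
    rw [← add_mul]
    gcongr
    exact hm t
  have hpartial : ∀ n, ∑ k ∈ Finset.range n, ∑' s, α s * w k s + ∑' s, m s * w n s ≤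
      ∑' s, m s := by
    intro n
    induction n with
    | zero => simp [hw0]
    | succ n ih =>
      rw [Finset.sum_range_succ, add_assoc]
      exact le_trans (by gcongr; exact hstep n) ih
  simp only [← ENNReal.tsum_mul_left]
  rw [ENNReal.tsum_comm, ENNReal.tsum_eq_iSup_nat]
  exact iSup_le fun n => le_self_add.trans (hpartial n)

/-- The measure `(t.1 + 1) * π (t.1 + 1, t.2)` counts pairs of a steady state and a tagged `H`
agent, indexed by what surrounds her. Stationarity makes it dominate the newly joining agents plus
the surviving ones, as `tsum_mul_sum_survival_le` requires. -/
theorem add_tsum_taggedStep_le {a pH pE : I} {d : ℕ} {π : PMF (ℕ × ℕ)}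
    (hπ : π.bind (step a pH pE d) = π) (t : ℕ × ℕ) :
    ENNReal.ofReal a * ENNReal.ofReal (1 - someEdge pH d) * π t +
        ∑' s : ℕ × ℕ, ((s.1 : ℝ≥0∞) + 1) * π (s.1 + 1, s.2) * taggedStep a pH pE d s t ≤
      ((t.1 : ℝ≥0∞) + 1) * π (t.1 + 1, t.2) := by
  classical
  set q := ENNReal.ofReal a * ENNReal.ofReal (1 - someEdge pH d)
  have hinj : Function.Injective fun s : ℕ × ℕ => (s.1 + 1, s.2) := by
    rintro ⟨a, b⟩ ⟨c, d⟩ h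
    simpa using h
  -- Reindexes by the whole state, tagged agent included; the factor `s.1` removes states without
  -- `H` agents, where `s.1 - 1` is truncated.
  let G : ℕ × ℕ → ℝ≥0∞ := fun s => π s * (s.1 * taggedStep a pH pE d (s.1 - 1, s.2) t)
  have hG : ∑' s : ℕ × ℕ, ((s.1 : ℝ≥0∞) + 1) * π (s.1 + 1, s.2) * taggedStep a pH pE d s t ≤
      ∑' s, G s := by
    refine le_trans (le_of_eq (tsum_congr fun s => ?_))
      (ENNReal.tsum_comp_le_tsum_of_injective hinj G)
    simp only [G, Nat.add_sub_cancel]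
    push_cast
    ring
  have hq : ∑' s, π s * (q * PMF.pure t s) = q * π t := by
    rw [tsum_eq_single t fun s hs => by simp [PMF.pure_apply, hs]]
    simp [mul_comm]
  have hflow : ((t.1 : ℝ≥0∞) + 1) * π (t.1 + 1, t.2) =
      ∑' s, π s * (((t.1 : ℝ≥0∞) + 1) * step a pH pE d s (t.1 + 1, t.2)) := by
    conv_lhs => rw [← hπ]
    simp only [PMF.bind_apply, ← ENNReal.tsum_mul_left, mul_left_comm]
  rw [hflow, ← hq]
  refine (add_le_add_right hG _).trans ?_
  rw [← ENNReal.tsum_add]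
  refine ENNReal.tsum_le_tsum fun s => ?_
  rw [← mul_add]
  refine mul_le_mul_right (le_of_eq ?_) _
  obtain ⟨h, e⟩ := s
  cases h with
  | zero => rw [step_zero_apply]; simp [q]
  | succ h => rw [step_succ_apply]; simp [q]

/-- Little's law: the mean number of waiting `H` agents bounds their arrival rate times their
average waiting time. -/
theorem waitH_le {lamH lamE : ℝ} (hH : 0 < lamH) (hE : 0 < lamE) {a : I}
    (ha : (a : ℝ) = lamH / (lamH + lamE)) {pH pE : I} {d : ℕ} {π : PMF (ℕ × ℕ)}
    (hπ : π.bind (step a pH pE d) = π) :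
    waitH lamH lamE pH pE d π ≤ π.mean (fun s => (s.1 : ℝ≥0∞)) / ENNReal.ofReal lamH := by
  have hsum : 0 < lamH + lamE := by linarith
  have ha1 : 1 - (a : ℝ) = lamE / (lamH + lamE) := by rw [ha]; field_simp; ring
  have h1 := tsum_mul_sum_survival_le (Q := taggedStep a pH pE d)
    (w := stillWaiting lamH lamE pH pE d) (fun s => rfl)
    (fun n s => by rw [stillWaiting]; simp only [taggedStep, ha1]; rw [← ha])
    (add_tsum_taggedStep_le hπ)
  have h2 : ∑' s : ℕ × ℕ, ((s.1 : ℝ≥0∞) + 1) * π (s.1 + 1, s.2) ≤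
      π.mean (fun s => (s.1 : ℝ≥0∞)) := by
    have hinj : Function.Injective fun s : ℕ × ℕ => (s.1 + 1, s.2) := by
      rintro ⟨a, b⟩ ⟨c, d⟩ h
      simpa using h
    refine le_trans (le_of_eq (tsum_congr fun s => ?_))
      (ENNReal.tsum_comp_le_tsum_of_injective hinj fun s => π s * (s.1 : ℝ≥0∞))
    push_cast
    ring
  have hl0 : ENNReal.ofReal lamH ≠ 0 := by simpa using hH
  rw [ENNReal.le_div_iff_mul_le (Or.inl hl0) (Or.inl ENNReal.ofReal_ne_top)]
  refine le_trans (le_of_eq ?_) (h1.trans h2)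
  have hlam : ENNReal.ofReal a = ENNReal.ofReal lamH * (ENNReal.ofReal (lamH + lamE))⁻¹ := by
    rw [ha, ENNReal.ofReal_div_of_pos hsum, div_eq_mul_inv]
  have hP : 1 - (someEdge pH d : ℝ) = (1 - (pH : ℝ)) ^ d := by rw [coe_someEdge]; ring
  rw [waitH, ← ENNReal.tsum_mul_right, hlam, hP]
  refine tsum_congr fun s => ?_
  rw [meanRemainingWait, div_eq_mul_inv]
  ring

end ChainMatching

/-! ### The limit of small `pH` -/

theorem theorem3 (lamH lamE : ℝ) (hH : 0 < lamH) (hE : 0 < lamE) (pE : I) (hpE : 0 < pE)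
    (d : ℕ) (hd : 1 ≤ d) :
    ∃ π : I → PMF (ℕ × ℕ),
      (∀ pH : I, 0 < pH →
        ChainMatching.IsSteadyState lamH lamE pH pE d (π pH) ∧
          ∀ ν : PMF (ℕ × ℕ), ChainMatching.IsSteadyState lamH lamE pH pE d ν → ν = π pH) ∧
      Filter.limsup
          (fun pH : I =>
            ENNReal.ofReal (pH : ℝ) * ChainMatching.waitH lamH lamE pH pE d (π pH))
          (𝓝[>] (0 : I)) ≤
        ENNReal.ofReal (Real.log (lamH / (lamE * (1 - (1 - (pE : ℝ)) ^ d)) + 1) / lamH) := by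
  have hsum : 0 < lamH + lamE := by linarith
  have hd0 : d ≠ 0 := by omega
  let a : I := ⟨lamH / (lamH + lamE), by positivity, (div_le_one hsum).2 (by linarith)⟩
  have ha : (a : ℝ) = lamH / (lamH + lamE) := rfl
  have ha1 : a < 1 := by
    rw [← Subtype.coe_lt_coe, ha]
    exact (div_lt_one hsum).2 (by simpa using hE)
  have hR := ChainMatching.someEdge_pos hpE hd0
  rw [← ChainMatching.coe_someEdge]
  set R : ℝ := ((ChainMatching.someEdge pE d : I) : ℝ) with hRdef
  have hx : 0 < lamH / (lamE * R) := by positivity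
  set y : ℝ := Real.log (lamH / (lamE * R) + 1) with hydef
  have hy : 0 ≤ y := Real.log_nonneg (by linarith)
  have hexp : Real.exp y = lamH / (lamE * R) + 1 := Real.exp_log (by linarith)
  -- At `pH * h = y` the limiting `H` inflow and removals balance; this determines `y`.
  have hbal : (a : ℝ) = (1 - a) * R * (Real.exp y - 1) := by
    rw [hexp, ha]
    field_simp
    ring
  -- The implication makes the choice total; the value at `pH = 0` is arbitrary and invisible to the
  -- right-sided limit.
  have hex : ∀ pH : I, ∃ π : PMF (ℕ × ℕ), 0 < pH →
      π.bind (ChainMatching.step a pH pE d) = π ∧ π.mean (fun s => (s.1 : ℝ≥0∞)) ≠ ∞ := by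
    intro pH
    by_cases hpH : 0 < pH
    · obtain ⟨π, h⟩ := ChainMatching.exists_stationary_step ha1 hpH hpE hd0
      exact ⟨π, fun _ => h⟩
    · exact ⟨PMF.pure (0, 0), fun h => absurd h hpH⟩
  choose π hπ using hex
  refine ⟨π, fun pH hpH => ⟨?_, fun ν hν => ?_⟩, ?_⟩
  · exact (ChainMatching.isSteadyState_iff hH hE ha pH pE d _).2 (hπ pH hpH).1
  · exact PMF.stationary_unique (ChainMatching.step_zero_ne_zero ha1 hpH hpE hd0) (hπ pH hpH).1
      ((ChainMatching.isSteadyState_iff hH hE ha pH pE d _).1 hν)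
  · have hbound : ∀ᶠ pH : I in 𝓝[>] (0 : I),
        ENNReal.ofReal (pH : ℝ) * ChainMatching.waitH lamH lamE pH pE d (π pH) ≤
          ENNReal.ofReal ((y + (Real.exp y - 1) * pH) / lamH) := by
      filter_upwards [self_mem_nhdsWithin] with pH hpH
      obtain ⟨h1, h2⟩ := hπ pH hpH
      calc _ ≤ ENNReal.ofReal (pH : ℝ) *
            ((π pH).mean (fun s => (s.1 : ℝ≥0∞)) / ENNReal.ofReal lamH) := by
              gcongr
              exact ChainMatching.waitH_le hH hE ha h1
        _ ≤ ENNReal.ofReal (y + (Real.exp y - 1) * pH) / ENNReal.ofReal lamH := by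
              rw [← mul_div_assoc]
              gcongr
              exact ChainMatching.mul_mean_fst_le hy ha1 hpE hd0 hbal h1 h2
        _ = _ := (ENNReal.ofReal_div_of_pos hH).symm
    have hlim : Filter.Tendsto
        (fun pH : I => ENNReal.ofReal ((y + (Real.exp y - 1) * pH) / lamH)) (𝓝[>] (0 : I))
        (𝓝 (ENNReal.ofReal (y / lamH))) := by
      have hcont : Continuous fun pH : I =>
          ENNReal.ofReal ((y + (Real.exp y - 1) * pH) / lamH) :=
        ENNReal.continuous_ofReal.comp (by fun_prop)
      simpa using (hcont.tendsto 0).mono_left nhdsWithin_le_nhds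
    have : (𝓝[>] (0 : I)).NeBot := nhdsGT_neBot_of_exists_gt ⟨1, zero_lt_one⟩
    exact (Filter.limsup_le_limsup hbound).trans hlim.limsup_eq.le
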